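/- For finite subsets $X,Y$ of an abelian group write $X+Y=\{x+y: x\in X,\ y\in Y\}$. For every $\nu>0$ there exist $\lambda>1$, $\varepsilon\in(0,1)$ and $c>0$, depending only on $\nu$, such that for every integer $s\ge 0$ there is $N_0=N_0(\nu,s)$ with the following properties. 1. For every prime $p\ge N_0$ there is $A\subseteq\mathbb{Z}/p\mathbb{Z}$ with $|A|\ge cp$ satisfying $(\ast)$. 2. For every integer $N\ge N_0$ there is $A\subseteq\{1,\dots,N\}\subset\mathbb{Z}$ with $|A|\ge cN$ satisfying $(\ast)$. 3. For every integer $n\ge N_0$ there is $A\subseteq\mathbb{F}_2^n$ with $|A|\ge c\,2^n$ satisfying $(\ast)$. Here $(\ast)$ says that $|A+A|\le\lambda|A|$ and that, for every $A'\subseteq A$ with $|A'|\ge(1-\varepsilon)|A|$ and every $A_{(s)}\subseteq A$ with $|A_{(s)}|\le s$, we have $|A'+A_{(s)}|\le\nu\,|A'+A|$. Consequently the following assertion (Question 5 of Bollobás, Leader and Tiba) is false: for all $\varepsilon,\lambda>0$ there is a constant $c>0$ such that, for every prime $p$ and all $A,B\subseteq\mathbb{Z}/p\mathbb{Z}$ with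 $|A|=|B|=n$ and $|A+B|\le\lambda n$, there are $A'\subseteq A$ and $B'\subseteq B$ with $|A'|\ge(1-\varepsilon)n$, $|B'|\le c$ and $|A'+B'|\ge(1-\varepsilon)|A'+B|$. -/

import Mathlib

open scoped Pointwise

/-- The finite set `A` has doubling at most `K`, and adding at most `s` elements of `A` to any
`A' ⊆ A` with `|A'| ≥ (1 - ε)|A|` produces at most a proportion `ν` of `A' + A`. -/
def IsNonSaturating {G : Type*} [AddCommGroup G] [DecidableEq G]
    (ν K ε : ℝ) (s : ℕ) (A : Finset G) : Prop :=
  ((A + A).card : ℝ) ≤ K * (A.card : ℝ) ∧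
    ∀ A' : Finset G, A' ⊆ A → (1 - ε) * (A.card : ℝ) ≤ (A'.card : ℝ) →
      ∀ S : Finset G, S ⊆ A → S.card ≤ s →
        ((A' + S).card : ℝ) ≤ ν * ((A' + A).card : ℝ)

/-- The assertion asked about by Bollobás, Leader and Tiba: for all `ε, K > 0` there is `c > 0`
such that any `A, B ⊆ ℤ/pℤ` (`p` prime) with `|A| = |B| = n` and `|A + B| ≤ K n` have subsets
`A' ⊆ A`, `B' ⊆ B` with `|A'| ≥ (1 - ε) n`, `|B'| ≤ c` and `|A' + B'| ≥ (1 - ε)|A' + B|`. -/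
def BoundedSaturation : Prop :=
  ∀ ε : ℝ, 0 < ε → ∀ K : ℝ, 0 < K → ∃ c : ℝ, 0 < c ∧
    ∀ p : ℕ, p.Prime → ∀ (n : ℕ) (A B : Finset (ZMod p)),
      A.card = n → B.card = n → ((A + B).card : ℝ) ≤ K * (n : ℝ) →
        ∃ A' B' : Finset (ZMod p), A' ⊆ A ∧ B' ⊆ B ∧
          (1 - ε) * (n : ℝ) ≤ (A'.card : ℝ) ∧ (B'.card : ℝ) ≤ c ∧
          (1 - ε) * ((A' + B).card : ℝ) ≤ ((A' + B').card : ℝ)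

/-!
The examples come from concentration of measure. In a product `Q` of `d` small groups, with Hamming
length `N`, let `f` be a sum of centred functions of one coordinate each. Put `B = {f ≥ θ √d}` and
`C = {f ≥ 0}`, and let `R` be the set of elements of length at most `τ √d`.

* A fourth moment bound shows that `B` and the complement of `C` have density at least an absolute
  constant (`tail_lower_bound`). Taking products over `k` blocks, `B` has density at least `κ ^ k`
  while `C` has density at most `(1 - κ) ^ k`, which is as small as desired (`SetModel`).
* For `r ∈ R` the difference `f (x + r) - f x` has mean zero and variance `O(√d)`, much less than
  `d`. By Chebyshev's inequality almost all of `B + r` lies in `C`, so that a bounded number of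
  elements of `R`, added to `B`, give little more than `C` when `d` is large
  (`SetModel.card_add_le`).
* By the Efron–Stein inequality the Hamming distance to a set `B'` of density bounded below has
  variance `O(d)`; if `τ` is large, `B' + R` is therefore at least half of `Q`
  (`VarianceBound.blow_up`).

Replacing `Q` by `H × Q`, `B` by `0 × B` and `R` by `H × R`, where `|H|` is a large constant, also
makes `B + B` small. This gives the sets of `exists_spreadPair`, whose density does not depend on
the number `s` of shifts. The coordinate groups may be chosen of distinct prime orders, coprime to
`|H|`, so that the whole group is cyclic, or all of order two.

Such a finite quotient is then lifted (`Tiling.exists_isNonSaturating`). Cut a large region of the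
ambient group into many tiles in bijection with `Q`, and let `A` consist of the copies of `B` in all
tiles and a single copy of `R`. The copy of `R` is a negligible part of `A`, so any `A'` contains
most of `B` in most tiles and `A' + A` fills a positive proportion of the region, whereas `A' + S`
lies, up to a negligible set, over `(B + B) ∪ (B + S')`, where `S' ⊆ R` is the image of the part of
`S` in the copy of `R`. Intervals of integers are tiled over cyclic groups, `𝔽₂ⁿ` over groups of
exponent two, and `ℤ/pℤ` inherits its example from the integers up to `(p - 1) / 2`, on whose sums
reduction modulo `p` is injective.
-/

/-! ### Averages over finite types -/

section Averages

open scoped BigOperators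

variable {α β : Type} [Fintype α] [Fintype β]

lemma expect_prod (F : α × β → ℝ) : 𝔼 p, F p = 𝔼 x, 𝔼 y, F (x, y) := by
  rw [← Finset.univ_product_univ, Finset.expect_product]

lemma expect_mul_prod (f : α → ℝ) (g : β → ℝ) :
    𝔼 p : α × β, f p.1 * g p.2 = (𝔼 x, f x) * 𝔼 y, g y := by
  rw [expect_prod, Fintype.expect_mul_expect]

lemma expect_fst [Nonempty β] (f : α → ℝ) : 𝔼 p : α × β, f p.1 = 𝔼 x, f x := by
  simpa using expect_mul_prod f (fun _ : β => 1)

lemma expect_snd [Nonempty α] (g : β → ℝ) : 𝔼 p : α × β, g p.2 = 𝔼 y, g y := by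
  simpa using expect_mul_prod (fun _ : α => 1) g

lemma expect_mono {f g : α → ℝ} (h : ∀ x, f x ≤ g x) : 𝔼 x, f x ≤ 𝔼 x, g x :=
  Finset.expect_le_expect fun x _ => h x

lemma expect_shift {Q : Type} [AddCommGroup Q] [Fintype Q] (f : Q → ℝ) (r : Q) :
    𝔼 x, f (x + r) = 𝔼 x, f x :=
  Fintype.expect_equiv (Equiv.addRight r) _ _ fun _ => rfl

lemma expect_indicator [DecidableEq α] (s : Finset α) :
    𝔼 x, (if x ∈ s then (1 : ℝ) else 0) = s.card / Fintype.card α := by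
  rw [Fintype.expect_eq_sum_div_card]; simp

end Averages

/-! ### Length functions and the Efron–Stein inequality -/

section Length

open scoped BigOperators

/-- A length function on an abelian group: it is even, subadditive and vanishes at `0`. -/
structure IsLength {Q : Type} [AddCommGroup Q] (N : Q → ℕ) : Prop where
  zero : N 0 = 0
  neg : ∀ x, N (-x) = N x
  add_le : ∀ x y, N (x + y) ≤ N x + N y

/-- `N` satisfies a Poincaré inequality with constant `D`: every real function which is
`1`-Lipschitz for `N` has variance at most `D`. -/
def VarianceBound {Q : Type} [AddCommGroup Q] [Fintype Q] (N : Q → ℕ) (D : ℝ) : Prop :=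
  ∀ g : Q → ℝ, (∀ x r, |g (x + r) - g x| ≤ N r) → 𝔼 x, g x ^ 2 - (𝔼 x, g x) ^ 2 ≤ D

variable {Q₁ Q₂ : Type} [AddCommGroup Q₁] [AddCommGroup Q₂]

lemma IsLength.prod {N₁ : Q₁ → ℕ} {N₂ : Q₂ → ℕ} (h₁ : IsLength N₁) (h₂ : IsLength N₂) :
    IsLength (fun p : Q₁ × Q₂ => N₁ p.1 + N₂ p.2) where
  zero := by simp [h₁.zero, h₂.zero]
  neg x := by simp [h₁.neg, h₂.neg]
  add_le x y := by
    have := h₁.add_le x.1 y.1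
    have := h₂.add_le x.2 y.2
    simp only [Prod.fst_add, Prod.snd_add]
    omega

/-- The Efron–Stein inequality: Poincaré constants add up under products. -/
lemma VarianceBound.prod [Fintype Q₁] [Fintype Q₂] {N₁ : Q₁ → ℕ} {N₂ : Q₂ → ℕ} {D₁ D₂ : ℝ}
    (z₁ : N₁ 0 = 0) (z₂ : N₂ 0 = 0) (h₁ : VarianceBound N₁ D₁) (h₂ : VarianceBound N₂ D₂) :
    VarianceBound (fun p : Q₁ × Q₂ => N₁ p.1 + N₂ p.2) (D₁ + D₂) := by
  intro g hg
  have e₁ := h₁ (fun x => 𝔼 y, g (x, y)) fun x r => by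
    rw [← Finset.expect_sub_distrib]
    refine (Finset.abs_expect_le _ _).trans (Finset.expect_le Finset.univ_nonempty fun y _ => ?_)
    simpa [z₂] using hg (x, y) (r, 0)
  have e₂ : 𝔼 x, (𝔼 y, g (x, y) ^ 2 - (𝔼 y, g (x, y)) ^ 2) ≤ D₂ :=
    Finset.expect_le Finset.univ_nonempty fun x _ => h₂ (fun y => g (x, y)) fun y r => by
      simpa [z₁] using hg (x, y) (0, r)
  rw [Finset.expect_sub_distrib] at e₂
  rw [expect_prod, expect_prod]
  linarith

/-- The trivial length, whose sums over the factors of a product are Hamming lengths. -/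
def discreteLength {G : Type} [AddCommGroup G] [DecidableEq G] (x : G) : ℕ := if x = 0 then 0 else 1

lemma isLength_discreteLength {G : Type} [AddCommGroup G] [DecidableEq G] :
    IsLength (discreteLength (G := G)) where
  zero := by simp [discreteLength]
  neg x := by simp [discreteLength]
  add_le x y := by
    unfold discreteLength
    split_ifs <;> simp_all

lemma varianceBound_discreteLength {G : Type} [AddCommGroup G] [DecidableEq G] [Fintype G] :
    VarianceBound (discreteLength (G := G)) 1 := by
  intro g hg
  have h : ∀ x, (g x - g 0) ^ 2 ≤ 1 := fun x => by
    have h1 : |g x - g 0| ≤ 1 := by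
      have := hg 0 x
      rw [zero_add] at this
      refine this.trans ?_
      unfold discreteLength
      split_ifs <;> simp
    rw [← sq_abs]
    exact pow_le_one₀ (abs_nonneg _) h1
  have e : 𝔼 x, (g x - g 0) ^ 2 ≤ 1 := Finset.expect_le Finset.univ_nonempty fun x _ => h x
  have e2 : 𝔼 x, (g x - g 0) ^ 2 = 𝔼 x, g x ^ 2 - 2 * g 0 * 𝔼 x, g x + g 0 ^ 2 := by
    rw [Finset.mul_expect, ← Finset.expect_sub_distrib]
    rw [← Fintype.expect_const (ι := G) (g 0 ^ 2), ← Finset.expect_add_distrib]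
    exact Finset.expect_congr rfl fun x _ => by ring
  nlinarith [sq_nonneg (𝔼 x, g x - g 0)]

end Length

/-! ### Moments of sums of independent functions -/

section SumModel

open scoped BigOperators

/-- The properties used of a sum `f` of `d` independent, bounded, centred functions of one coordinate
each on a product of `d` groups with Hamming length `N`. -/
structure SumModel {Q : Type} [AddCommGroup Q] [Fintype Q] (N : Q → ℕ) (f : Q → ℝ) (d : ℕ) :
    Prop where
  length : IsLength N
  variance : VarianceBound N d
  mean : 𝔼 x, f x = 0
  le_sq : 2 / 9 * (d : ℝ) ≤ 𝔼 x, f x ^ 2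
  sq_le : 𝔼 x, f x ^ 2 ≤ d
  fourth_le : 𝔼 x, f x ^ 4 ≤ 3 * (d : ℝ) ^ 2
  shift_le : ∀ r, 𝔼 x, (f (x + r) - f x) ^ 2 ≤ 4 * N r

lemma SumModel.prod {Q₁ Q₂ : Type} [AddCommGroup Q₁] [Fintype Q₁] [AddCommGroup Q₂] [Fintype Q₂]
    {N₁ : Q₁ → ℕ} {N₂ : Q₂ → ℕ} {f₁ : Q₁ → ℝ} {f₂ : Q₂ → ℝ} {d₁ d₂ : ℕ}
    (h₁ : SumModel N₁ f₁ d₁) (h₂ : SumModel N₂ f₂ d₂) :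
    SumModel (fun p : Q₁ × Q₂ => N₁ p.1 + N₂ p.2) (fun p => f₁ p.1 + f₂ p.2) (d₁ + d₂) := by
  -- second moment of a sum of two independent functions, one of which is centred
  have sq : ∀ (u : Q₁ → ℝ) (v : Q₂ → ℝ), 𝔼 x, u x = 0 →
      𝔼 p : Q₁ × Q₂, (u p.1 + v p.2) ^ 2 = 𝔼 x, u x ^ 2 + 𝔼 y, v y ^ 2 := by
    intro u v hu
    have : ∀ p : Q₁ × Q₂, (u p.1 + v p.2) ^ 2 = u p.1 ^ 2 + 2 * (u p.1 * v p.2) + v p.2 ^ 2 :=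
      fun p => by ring
    simp_rw [this]
    rw [Finset.expect_add_distrib, Finset.expect_add_distrib, ← Finset.mul_expect,
      expect_mul_prod u v, hu, expect_fst (fun x => u x ^ 2), expect_snd (fun x => v x ^ 2)]
    ring
  refine ⟨h₁.length.prod h₂.length, ?_, ?_, ?_, ?_, ?_, ?_⟩
  · push_cast
    exact h₁.variance.prod h₁.length.zero h₂.length.zero h₂.variance
  · rw [Finset.expect_add_distrib, expect_fst, expect_snd, h₁.mean, h₂.mean, add_zero]
  · rw [sq _ _ h₁.mean]
    push_cast
    linarith [h₁.le_sq, h₂.le_sq]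
  · rw [sq _ _ h₁.mean]
    push_cast
    linarith [h₁.sq_le, h₂.sq_le]
  · have : ∀ p : Q₁ × Q₂, (f₁ p.1 + f₂ p.2) ^ 4 = f₁ p.1 ^ 4 + 4 * (f₁ p.1 ^ 3 * f₂ p.2)
        + 6 * (f₁ p.1 ^ 2 * f₂ p.2 ^ 2) + 4 * (f₁ p.1 * f₂ p.2 ^ 3) + f₂ p.2 ^ 4 :=
      fun p => by ring
    simp_rw [this]
    simp only [Finset.expect_add_distrib, ← Finset.mul_expect]
    rw [expect_mul_prod (fun x => f₁ x ^ 3) f₂, expect_mul_prod f₁ (fun x => f₂ x ^ 3),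
      expect_mul_prod (fun x => f₁ x ^ 2) (fun x => f₂ x ^ 2),
      expect_fst (fun x => f₁ x ^ 4), expect_snd (fun x => f₂ x ^ 4), h₁.mean, h₂.mean]
    have h22 : (𝔼 x, f₁ x ^ 2) * (𝔼 x, f₂ x ^ 2) ≤ d₁ * d₂ :=
      mul_le_mul h₁.sq_le h₂.sq_le (Finset.expect_nonneg fun _ _ => sq_nonneg _) (Nat.cast_nonneg _)
    push_cast
    nlinarith [h₁.fourth_le, h₂.fourth_le]
  · intro r
    have : ∀ x : Q₁ × Q₂, f₁ (x + r).1 + f₂ (x + r).2 - (f₁ x.1 + f₂ x.2)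
        = (f₁ (x.1 + r.1) - f₁ x.1) + (f₂ (x.2 + r.2) - f₂ x.2) := fun x => by
      simp only [Prod.fst_add, Prod.snd_add]; ring
    simp_rw [this]
    rw [sq (fun x => f₁ (x + r.1) - f₁ x) (fun y => f₂ (y + r.2) - f₂ y)
      (by rw [Finset.expect_sub_distrib, expect_shift, sub_self])]
    push_cast
    linarith [h₁.shift_le r.1, h₂.shift_le r.2]

lemma sumModel_zero : SumModel (Q := PUnit) (fun _ => 0) (fun _ => 0) 0 := by
  refine ⟨⟨rfl, fun _ => rfl, fun _ _ => le_rfl⟩, fun g _ => ?_, ?_, ?_, ?_, ?_, ?_⟩ <;> simp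

/-- The summand for a single coordinate: the centred indicator of half of the group. -/
lemma exists_sumModel_one (G : Type) [AddCommGroup G] [Fintype G] [DecidableEq G] [Nontrivial G] :
    ∃ φ : G → ℝ, SumModel (discreteLength (G := G)) φ 1 := by
  obtain ⟨U, -, hU⟩ := Finset.exists_subset_card_eq
    (s := (Finset.univ : Finset G)) (n := Fintype.card G / 2) (by simp; omega)
  set u : ℝ := 𝔼 x, (if x ∈ U then (1 : ℝ) else 0) with hu
  have huc : u * Fintype.card G = U.card := by
    rw [hu, expect_indicator]
    field_simp
  have hn : 2 ≤ Fintype.card G := Fintype.one_lt_card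
  have h1 : u ≤ 1 / 2 := by
    have : (U.card : ℝ) * 2 ≤ Fintype.card G := by
      rw [hU]; exact_mod_cast Nat.div_mul_le_self _ _
    have h2 : (2 : ℝ) ≤ Fintype.card G := by exact_mod_cast hn
    nlinarith
  have h2 : 1 / 3 ≤ u := by
    have : (Fintype.card G : ℝ) ≤ 3 * U.card := by
      rw [hU]; exact_mod_cast (by omega)
    have h2 : (2 : ℝ) ≤ Fintype.card G := by exact_mod_cast hn
    nlinarith
  have hmean : 𝔼 x, ((if x ∈ U then (1 : ℝ) else 0) - u) = 0 := by
    rw [Finset.expect_sub_distrib, Fintype.expect_const, ← hu, sub_self]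
  have hsq : 𝔼 x, ((if x ∈ U then (1 : ℝ) else 0) - u) ^ 2 = u - u ^ 2 := by
    have : ∀ x, ((if x ∈ U then (1 : ℝ) else 0) - u) ^ 2
        = (1 - 2 * u) * (if x ∈ U then (1 : ℝ) else 0) + u ^ 2 := fun x => by
      split_ifs <;> ring
    simp_rw [this]
    rw [Finset.expect_add_distrib, Fintype.expect_const, ← Finset.mul_expect, ← hu]
    ring
  refine ⟨fun x => (if x ∈ U then (1 : ℝ) else 0) - u, isLength_discreteLength, ?_, hmean,
    ?_, ?_, ?_, ?_⟩
  · simpa using varianceBound_discreteLength (G := G)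
  · rw [hsq]; push_cast; nlinarith
  · rw [hsq]; push_cast; nlinarith
  · refine Finset.expect_le Finset.univ_nonempty fun x _ => ?_
    have : ((if x ∈ U then (1 : ℝ) else 0) - u) ^ 2 ≤ 1 := by split_ifs <;> nlinarith
    have h0 := sq_nonneg ((if x ∈ U then (1 : ℝ) else 0) - u)
    push_cast
    nlinarith
  · intro r
    refine Finset.expect_le Finset.univ_nonempty fun x _ => ?_
    by_cases hr : r = 0
    · simp [hr, discreteLength]
    · simp only [discreteLength, hr, if_false]
      split_ifs <;> ring_nf <;> norm_num

end SumModel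

/-! ### Tail bounds -/

section TailBounds

open scoped BigOperators

/-- A Paley–Zygmund bound: a centred function whose second moment is bounded below and whose fourth
moment is bounded above is bounded below by a positive constant on a positive proportion of the
space. -/
lemma tail_lower_bound {Q : Type} [Fintype Q] [Nonempty Q] [DecidableEq Q] {h : Q → ℝ}
    (h1 : 𝔼 x, h x = 0) (h2 : 2 / 9 ≤ 𝔼 x, h x ^ 2)
    (h4 : 𝔼 x, h x ^ 4 ≤ 3) :
    1 / 15552 * (Fintype.card Q : ℝ) ≤ (Finset.univ.filter fun x => 1 / 432 ≤ h x).card := by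
  set P := Finset.univ.filter fun x => 1 / 432 ≤ h x with hP
  -- bound the positive part of `h` from below through `h ^ 2 ≤ 6 * |h| + h ^ 4 / 36`
  -- and from above through the event `P`
  have key : ∀ x, 1 / 2 * h x + 1 / 12 * h x ^ 2 - 1 / 432 * h x ^ 4 ≤
      1 / 432 + 1 / 432 * h x ^ 2 + 108 * (if x ∈ P then (1 : ℝ) else 0) := by
    intro x
    have e1 : h x ^ 2 ≤ 6 * |h x| + 1 / 36 * h x ^ 4 := by
      rcases le_total |h x| 6 with h6 | h6
      · nlinarith [abs_nonneg (h x), sq_abs (h x), sq_nonneg (h x ^ 2)]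
      · have : 36 ≤ h x ^ 2 := by nlinarith [sq_abs (h x)]
        nlinarith [abs_nonneg (h x)]
    by_cases hx : 1 / 432 ≤ h x
    · rw [if_pos (by simpa [hP] using hx)]
      rw [abs_of_nonneg (by linarith)] at e1
      nlinarith [sq_nonneg (h x - 216)]
    · rw [if_neg (by simpa [hP] using hx)]
      push Not at hx
      rcases le_total 0 (h x) with h0 | h0
      · rw [abs_of_nonneg h0] at e1
        nlinarith
      · rw [abs_of_nonpos h0] at e1
        nlinarith
  have := expect_mono key
  simp only [Finset.expect_sub_distrib, Finset.expect_add_distrib, ← Finset.mul_expect,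
    Fintype.expect_const, expect_indicator] at this
  have hc : (0 : ℝ) < Fintype.card Q := by exact_mod_cast Fintype.card_pos
  have : 1 / 15552 ≤ (P.card : ℝ) / Fintype.card Q := by linarith
  rwa [le_div_iff₀ hc] at this

end TailBounds

/-! ### Level sets and their translates -/

section SetModel

open scoped BigOperators

/-- A set `B` of density at least `b` and a set `C` of density at most `c` such that each translate
`B + r` is contained in `C` up to a set of density `η * N r`, for a length `N` satisfying a
Poincaré inequality with constant `D`. -/
structure SetModel {Q : Type} [AddCommGroup Q] [Fintype Q] [DecidableEq Q] (N : Q → ℕ)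
    (B C : Finset Q) (b c η D : ℝ) : Prop where
  length : IsLength N
  variance : VarianceBound N D
  le_card : b * (Fintype.card Q : ℝ) ≤ B.card
  card_le : (C.card : ℝ) ≤ c * Fintype.card Q
  shift_le : ∀ r, ((B.filter fun x => x + r ∉ C).card : ℝ) ≤ η * N r * Fintype.card Q

/-- The set of points where a sum of `d` centred functions is at least a multiple of its standard
deviation, and the set where it is nonnegative. -/
lemma SumModel.exists_setModel {Q : Type} [AddCommGroup Q] [Fintype Q] [DecidableEq Q] {N : Q → ℕ}
    {f : Q → ℝ} {d : ℕ} (h : SumModel N f d) (hd : 0 < d) :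
    ∃ B C, SetModel N B C (1 / 15552) (1 - 1 / 15552) (746496 / d) d := by
  have hd' : (0 : ℝ) < d := by exact_mod_cast hd
  have hr : 0 < √(d : ℝ) := Real.sqrt_pos.2 hd'
  have hr2 : √(d : ℝ) ^ 2 = d := Real.sq_sqrt hd'.le
  have hr4 : √(d : ℝ) ^ 4 = (d : ℝ) ^ 2 := by
    rw [show 4 = 2 * 2 from rfl, pow_mul, hr2]
  have hc : (0 : ℝ) < Fintype.card Q := by exact_mod_cast Fintype.card_pos
  have m1 : 𝔼 x, f x / √(d : ℝ) = 0 := by rw [← Finset.expect_div, h.mean, zero_div]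
  have m2 : 2 / 9 ≤ 𝔼 x, (f x / √(d : ℝ)) ^ 2 := by
    simp_rw [div_pow, hr2]
    rw [← Finset.expect_div, le_div_iff₀ hd']
    exact h.le_sq
  have m4 : 𝔼 x, (f x / √(d : ℝ)) ^ 4 ≤ 3 := by
    simp_rw [div_pow, hr4]
    rw [← Finset.expect_div, div_le_iff₀ (by positivity)]
    exact h.fourth_le
  have t1 := tail_lower_bound m1 m2 m4
  have t2 := tail_lower_bound (h := fun x => -(f x / √(d : ℝ)))
    (by rw [Finset.expect_neg_distrib, m1, neg_zero]) (by simpa only [neg_sq] using m2)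
    (by simpa only [Even.neg_pow (by decide : Even 4)] using m4)
  refine ⟨Finset.univ.filter fun x => 1 / 432 ≤ f x / √(d : ℝ), Finset.univ.filter fun x => 0 ≤ f x,
    h.length, h.variance, t1, ?_, fun r => ?_⟩
  · have hdisj : Disjoint (Finset.univ.filter fun x => 1 / 432 ≤ -(f x / √(d : ℝ)))
        (Finset.univ.filter fun x => 0 ≤ f x) := by
      rw [Finset.disjoint_left]
      intro x hx hx'
      rw [Finset.mem_filter] at hx hx'
      have := div_nonneg hx'.2 hr.le
      linarith [hx.2]
    have := Finset.card_le_univ (Finset.disjUnion _ _ hdisj)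
    rw [Finset.card_disjUnion] at this
    have : ((Finset.univ.filter fun x => 1 / 432 ≤ -(f x / √(d : ℝ))).card : ℝ)
        + (Finset.univ.filter fun x => 0 ≤ f x).card ≤ Fintype.card Q := by exact_mod_cast this
    linarith
  · -- Chebyshev's inequality for `f (x + r) - f x`
    set P := (Finset.univ.filter fun x => 1 / 432 ≤ f x / √(d : ℝ)).filter
      fun x => x + r ∉ Finset.univ.filter fun x => 0 ≤ f x with hP
    have key : ∀ x, (d : ℝ) / 186624 * (if x ∈ P then (1 : ℝ) else 0) ≤ (f (x + r) - f x) ^ 2 := by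
      intro x
      split_ifs with hx
      · simp only [hP, Finset.mem_filter, Finset.mem_univ, true_and, not_le] at hx
        obtain ⟨ha, hb⟩ := hx
        rw [le_div_iff₀ hr] at ha
        have : 1 / 432 * √(d : ℝ) ≤ f x - f (x + r) := by linarith
        nlinarith
      · rw [mul_zero]; positivity
    have := (expect_mono key).trans (h.shift_le r)
    rw [← Finset.mul_expect, expect_indicator] at this
    have e : (P.card : ℝ) = (d : ℝ) / 186624 * (P.card / Fintype.card Q)
        * (186624 / d * Fintype.card Q) := by field_simp
    rw [e]
    calc _ ≤ 4 * (N r : ℝ) * (186624 / d * Fintype.card Q) := by gcongr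
      _ = _ := by ring

lemma SetModel.prod {Q₁ Q₂ : Type} [AddCommGroup Q₁] [Fintype Q₁] [DecidableEq Q₁]
    [AddCommGroup Q₂] [Fintype Q₂] [DecidableEq Q₂] {N₁ : Q₁ → ℕ} {N₂ : Q₂ → ℕ}
    {B₁ C₁ : Finset Q₁} {B₂ C₂ : Finset Q₂} {b₁ b₂ c₁ c₂ η D₁ D₂ : ℝ}
    (h₁ : SetModel N₁ B₁ C₁ b₁ c₁ η D₁) (h₂ : SetModel N₂ B₂ C₂ b₂ c₂ η D₂)
    (hb : 0 ≤ b₂) (hc : 0 ≤ c₁) :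
    SetModel (fun p : Q₁ × Q₂ => N₁ p.1 + N₂ p.2) (B₁ ×ˢ B₂) (C₁ ×ˢ C₂)
      (b₁ * b₂) (c₁ * c₂) η (D₁ + D₂) := by
  refine ⟨h₁.length.prod h₂.length,
    h₁.variance.prod h₁.length.zero h₂.length.zero h₂.variance, ?_, ?_, fun r => ?_⟩
  · rw [Finset.card_product, Fintype.card_prod]
    push_cast
    calc b₁ * b₂ * ((Fintype.card Q₁ : ℝ) * Fintype.card Q₂)
        = (b₁ * Fintype.card Q₁) * (b₂ * Fintype.card Q₂) := by ring
      _ ≤ _ := mul_le_mul h₁.le_card h₂.le_card (by positivity) (by positivity)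
  · rw [Finset.card_product, Fintype.card_prod]
    push_cast
    calc (C₁.card : ℝ) * C₂.card ≤ (c₁ * Fintype.card Q₁) * (c₂ * Fintype.card Q₂) :=
          mul_le_mul h₁.card_le h₂.card_le (by positivity) (by positivity)
      _ = _ := by ring
  · have hsub : ((B₁ ×ˢ B₂).filter fun x => x + r ∉ C₁ ×ˢ C₂) ⊆
        (B₁.filter fun x => x + r.1 ∉ C₁) ×ˢ Finset.univ ∪
          Finset.univ ×ˢ (B₂.filter fun x => x + r.2 ∉ C₂) := by
      intro x hx
      simp only [Finset.mem_filter, Finset.mem_product, Prod.fst_add, Prod.snd_add,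
        Finset.mem_union, Finset.mem_univ, and_true, true_and] at hx ⊢
      tauto
    have := (Finset.card_le_card hsub).trans (Finset.card_union_le _ _)
    rw [Finset.card_product, Finset.card_product, Finset.card_univ, Finset.card_univ] at this
    have : (((B₁ ×ˢ B₂).filter fun x => x + r ∉ C₁ ×ˢ C₂).card : ℝ) ≤
        (B₁.filter fun x => x + r.1 ∉ C₁).card * Fintype.card Q₂ +
        Fintype.card Q₁ * (B₂.filter fun x => x + r.2 ∉ C₂).card := by exact_mod_cast this
    refine this.trans ?_
    rw [Fintype.card_prod]
    push_cast
    calc _ ≤ η * N₁ r.1 * Fintype.card Q₁ * Fintype.card Q₂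
          + Fintype.card Q₁ * (η * N₂ r.2 * Fintype.card Q₂) := by
          gcongr
          · exact h₁.shift_le _
          · exact h₂.shift_le _
      _ = _ := by ring

lemma setModel_zero (η : ℝ) :
    SetModel (Q := PUnit) (fun _ => 0) Finset.univ Finset.univ 1 1 η 0 := by
  refine ⟨⟨rfl, fun _ => rfl, fun _ _ => le_rfl⟩, fun g _ => ?_, ?_, ?_, ?_⟩ <;> simp

/-- A Poincaré inequality makes the elements of length at most `t` expand every dense set to at
least half of the group. -/
lemma VarianceBound.blow_up {Q : Type} [AddCommGroup Q] [Fintype Q] [DecidableEq Q] {N : Q → ℕ}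
    {D β t : ℝ} (hN : IsLength N) (hD : VarianceBound N D) (hβ : 0 < β) (ht : 0 < t)
    (htD : 4 * D / β ≤ t ^ 2) {B : Finset Q} (hB : β * (Fintype.card Q : ℝ) ≤ B.card) :
    (Fintype.card Q : ℝ) ≤ 2 * (B + Finset.univ.filter fun r => (N r : ℝ) ≤ t).card := by
  have hc : (0 : ℝ) < Fintype.card Q := by exact_mod_cast Fintype.card_pos
  have hne : B.Nonempty := by
    rw [← Finset.card_pos]
    have : (0 : ℝ) < B.card := lt_of_lt_of_le (by positivity) hB
    exact_mod_cast this
  set R := Finset.univ.filter fun r => (N r : ℝ) ≤ t with hR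
  -- the distance to `B`
  let g : Q → ℕ := fun x => B.inf' hne fun b => N (x - b)
  have hg : ∀ x r, (g (x + r) : ℝ) ≤ g x + N r := by
    intro x r
    obtain ⟨b, hb, hgb⟩ := Finset.exists_mem_eq_inf' hne fun b => N (x - b)
    have h1 : g (x + r) ≤ N (x + r - b) := Finset.inf'_le _ hb
    have h2 : N (x + r - b) ≤ N (x - b) + N r := by
      rw [show x + r - b = (x - b) + r by abel]; exact hN.add_le _ _
    have h3 : g x = N (x - b) := hgb
    rw [h3]
    exact_mod_cast h1.trans h2
  have hvar := hD (fun x => (g x : ℝ)) fun x r => by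
    rw [abs_le]
    have h1 := hg x r
    have h2 := hg (x + r) (-r)
    rw [add_neg_cancel_right, hN.neg] at h2
    constructor <;> linarith
  set μ := 𝔼 x, (g x : ℝ) with hμ
  have hμ0 : 0 ≤ μ := Finset.expect_nonneg fun _ _ => Nat.cast_nonneg _
  have hgB : ∀ x ∈ B, g x = 0 := by
    intro x hx
    have : g x ≤ N (x - x) := Finset.inf'_le _ hx
    rw [sub_self, hN.zero] at this
    omega
  have e1 : μ ^ 2 * β ≤ D := by
    have key : ∀ x, μ ^ 2 * (if x ∈ B then (1 : ℝ) else 0) ≤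
        (g x : ℝ) ^ 2 - 2 * μ * g x + μ ^ 2 := by
      intro x
      split_ifs with hx
      · rw [hgB x hx]; simp
      · nlinarith [sq_nonneg ((g x : ℝ) - μ)]
    have := expect_mono key
    simp only [Finset.expect_sub_distrib, Finset.expect_add_distrib, ← Finset.mul_expect,
      Fintype.expect_const, expect_indicator] at this
    rw [← hμ] at this
    have h3 : β ≤ (B.card : ℝ) / Fintype.card Q := by rwa [le_div_iff₀ hc]
    have h4 := mul_le_mul_of_nonneg_left h3 (sq_nonneg μ)
    linarith
  have e2 : 2 * μ ≤ t := by
    have : (2 * μ) ^ 2 ≤ t ^ 2 := by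
      refine le_trans ?_ htD
      rw [le_div_iff₀ hβ]
      linarith
    exact le_of_sq_le_sq this ht.le
  have e3 : t * (1 - (B + R).card / Fintype.card Q) ≤ μ := by
    have key : ∀ x, t * (1 - if x ∈ B + R then (1 : ℝ) else 0) ≤ g x := by
      intro x
      split_ifs with hx
      · simp
      · by_contra hlt
        push Not at hlt
        obtain ⟨b, hb, hgb⟩ := Finset.exists_mem_eq_inf' hne fun b => N (x - b)
        have h3 : g x = N (x - b) := hgb
        refine hx (Finset.mem_add.2 ⟨b, hb, x - b, ?_, by abel⟩)
        rw [h3] at hlt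
        simp only [hR, Finset.mem_filter, Finset.mem_univ, true_and]
        linarith
    have := expect_mono key
    rwa [← Finset.mul_expect, Finset.expect_sub_distrib, Fintype.expect_const,
      expect_indicator] at this
  have e4 : 1 - ((B + R).card : ℝ) / Fintype.card Q ≤ 1 / 2 := by
    by_contra hlt
    push Not at hlt
    nlinarith
  have e5 : 1 / 2 ≤ ((B + R).card : ℝ) / Fintype.card Q := by linarith
  rw [le_div_iff₀ hc] at e5
  linarith

/-- Few translates of `B` cover little more than `C`. -/
lemma SetModel.card_add_le {Q : Type} [AddCommGroup Q] [Fintype Q] [DecidableEq Q] {N : Q → ℕ}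
    {B C : Finset Q} {b c η D t : ℝ} (h : SetModel N B C b c η D) (hη : 0 ≤ η) (ht : 0 ≤ t)
    {S : Finset Q} {s : ℕ} (hS : ∀ r ∈ S, (N r : ℝ) ≤ t) (hs : S.card ≤ s) :
    ((B + S).card : ℝ) ≤ (c + s * (η * t)) * Fintype.card Q := by
  have hsub : B + S ⊆ C ∪ S.biUnion fun r => (B.filter fun x => x + r ∉ C).image (· + r) := by
    intro y hy
    obtain ⟨x, hx, r, hr, rfl⟩ := Finset.mem_add.1 hy
    by_cases hC : x + r ∈ C
    · exact Finset.mem_union_left _ hC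
    · refine Finset.mem_union_right _ (Finset.mem_biUnion.2 ⟨r, hr, Finset.mem_image.2 ⟨x, ?_, rfl⟩⟩)
      exact Finset.mem_filter.2 ⟨hx, hC⟩
  have h1 := (Finset.card_le_card hsub).trans (Finset.card_union_le _ _)
  have h2 : (((S.biUnion fun r => (B.filter fun x => x + r ∉ C).image (· + r)).card : ℕ) : ℝ) ≤
      ∑ r ∈ S, η * t * Fintype.card Q := by
    refine (Nat.cast_le.2 Finset.card_biUnion_le).trans ?_
    push_cast
    refine Finset.sum_le_sum fun r hr => (Nat.cast_le.2 Finset.card_image_le).trans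
      ((h.shift_le r).trans ?_)
    have := hS r hr
    gcongr
  rw [Finset.sum_const, nsmul_eq_mul] at h2
  have h3 : (S.card : ℝ) * (η * t * Fintype.card Q) ≤ s * (η * t * Fintype.card Q) := by
    gcongr
  have h4 : ((B + S).card : ℝ) ≤ C.card +
      (S.biUnion fun r => (B.filter fun x => x + r ∉ C).image (· + r)).card := by exact_mod_cast h1
  have := h.card_le
  linarith

end SetModel

/-! ### Spread pairs in classes of finite groups -/

section GroupClass

/-- An isomorphism-invariant class of abelian groups which contains groups of every order `2 ^ l`
and in which every finite group has a nontrivial finite extension by a direct factor. -/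
structure GroupClass (P : (Q : Type) → [AddCommGroup Q] → Prop) : Prop where
  congr : ∀ {Q Q' : Type} [AddCommGroup Q] [AddCommGroup Q'], Q ≃+ Q' → P Q → P Q'
  extend : ∀ (Q : Type) [AddCommGroup Q] [Fintype Q], P Q →
    ∃ (G : Type) (_ : AddCommGroup G) (_ : Fintype G) (_ : Nontrivial G), P (Q × G)
  two_pow : ∀ l : ℕ, ∃ (H : Type) (_ : AddCommGroup H) (_ : Fintype H), P H ∧ Fintype.card H = 2 ^ l

variable {P : (Q : Type) → [AddCommGroup Q] → Prop}

lemma GroupClass.exists_sumModel (hP : GroupClass P) (Q₀ : Type) [AddCommGroup Q₀] [Fintype Q₀]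
    (h₀ : P Q₀) (d : ℕ) :
    ∃ (Q : Type) (_ : AddCommGroup Q) (_ : Fintype Q) (N : Q → ℕ) (f : Q → ℝ),
      P (Q₀ × Q) ∧ SumModel N f d := by
  classical
  induction d with
  | zero => exact ⟨PUnit, inferInstance, inferInstance, _, _,
      hP.congr AddEquiv.prodUnique.symm h₀, sumModel_zero⟩
  | succ d ih =>
    obtain ⟨Q, _, _, N, f, hQ, hM⟩ := ih
    obtain ⟨G, _, _, _, hG⟩ := hP.extend _ hQ
    obtain ⟨φ, hφ⟩ := exists_sumModel_one G
    exact ⟨Q × G, inferInstance, inferInstance, _, _, hP.congr AddEquiv.prodAssoc hG, hM.prod hφ⟩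

lemma GroupClass.exists_setModel (hP : GroupClass P) (Q₀ : Type) [AddCommGroup Q₀] [Fintype Q₀]
    (h₀ : P Q₀) {d : ℕ} (hd : 0 < d) (k : ℕ) :
    ∃ (Q : Type) (_ : AddCommGroup Q) (_ : Fintype Q) (_ : DecidableEq Q) (N : Q → ℕ)
      (B C : Finset Q), P (Q₀ × Q) ∧
        SetModel N B C ((1 / 15552) ^ k) ((1 - 1 / 15552) ^ k) (746496 / d) (k * d) := by
  classical
  induction k with
  | zero => exact ⟨PUnit, inferInstance, inferInstance, inferInstance, _, _, _,
      hP.congr AddEquiv.prodUnique.symm h₀, by simpa using setModel_zero (746496 / d)⟩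
  | succ k ih =>
    obtain ⟨Q, _, _, _, N, B, C, hQ, hM⟩ := ih
    obtain ⟨Q', _, _, N', f, hQ', hM'⟩ := hP.exists_sumModel _ hQ d
    obtain ⟨B', C', hBC⟩ := hM'.exists_setModel hd
    have key := hM.prod hBC (by norm_num) (by norm_num)
    rw [← pow_succ, ← pow_succ,
      show (k : ℝ) * d + d = ((k + 1 : ℕ) : ℝ) * d by push_cast; ring] at key
    exact ⟨Q × Q', inferInstance, inferInstance, inferInstance, _, _, _,
      hP.congr AddEquiv.prodAssoc hQ', key⟩

/-- A set `B` of density at least `b` in a finite group, together with a set `R` of shifts. Adding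
`R` to at least half of `B` gives at least half of the group, but adding to `B` either `B` itself or
at most `s` elements of `R` gives a proportion at most `ν` of the group. -/
structure SpreadPair {Q : Type} [AddCommGroup Q] [Fintype Q] [DecidableEq Q] (ν b : ℝ) (s : ℕ)
    (B R : Finset Q) : Prop where
  le_card : b * (Fintype.card Q : ℝ) ≤ B.card
  add_self_le : ((B + B).card : ℝ) ≤ ν * Fintype.card Q
  add_le : ∀ S ⊆ R, S.card ≤ s → ((B + S).card : ℝ) ≤ ν * Fintype.card Q
  le_add : ∀ B' ⊆ B, (B.card : ℝ) ≤ 2 * B'.card → (Fintype.card Q : ℝ) ≤ 2 * (B' + R).card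

/-- Spread pairs exist in every admissible class, with a density `b` that does not depend on `s`.
The factor `H` of a product `H × Q` serves to make `B + B` small, `B` being contained in `0 × Q`. -/
theorem exists_spreadPair {ν : ℝ} (hν : 0 < ν) : ∃ b : ℝ, 0 < b ∧
    ∀ (P : (Q : Type) → [AddCommGroup Q] → Prop), GroupClass P → ∀ s : ℕ,
      ∃ (Q : Type) (_ : AddCommGroup Q) (_ : Fintype Q) (_ : DecidableEq Q) (B R : Finset Q),
        P Q ∧ SpreadPair ν b s B R := by
  classical
  obtain ⟨l, hl⟩ := exists_pow_lt_of_lt_one hν (by norm_num : (1 / 2 : ℝ) < 1)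
  obtain ⟨k, hk⟩ := exists_pow_lt_of_lt_one (half_pos hν) (by norm_num : (1 - 1 / 15552 : ℝ) < 1)
  set κ : ℝ := (1 / 15552) ^ k with hκ
  have hκ0 : 0 < κ := by positivity
  refine ⟨κ * (1 / 2) ^ l, by positivity, fun P hP s => ?_⟩
  obtain ⟨H, _, _, hH, hHc⟩ := hP.two_pow l
  set τ : ℝ := √(8 * (k + 1) / κ) with hτ
  have hτ0 : 0 < τ := Real.sqrt_pos.2 (by positivity)
  have hτ2 : τ ^ 2 = 8 * (k + 1) / κ := Real.sq_sqrt (by positivity)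
  -- the dimension is large enough for `s` shifts of length `τ * √d` to be harmless
  obtain ⟨d, hd⟩ := exists_nat_gt (max 0 ((s * 746496 * τ / (ν / 2)) ^ 2))
  have hd0 : (0 : ℝ) < d := (le_max_left _ _).trans_lt hd
  have hd1 : (s * 746496 * τ / (ν / 2)) ^ 2 < d := (le_max_right _ _).trans_lt hd
  have hr : 0 < √(d : ℝ) := Real.sqrt_pos.2 hd0
  have hr2 : √(d : ℝ) ^ 2 = d := Real.sq_sqrt hd0.le
  have hd2 : s * 746496 * τ / (ν / 2) ≤ √(d : ℝ) := Real.le_sqrt_of_sq_le hd1.le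
  obtain ⟨Q, _, _, _, N, B, C, hQ, hM⟩ :=
    hP.exists_setModel H hH (d := d) (by exact_mod_cast hd0) k
  set t : ℝ := τ * √(d : ℝ) with ht
  have ht0 : 0 < t := by positivity
  set R := Finset.univ.filter fun r => (N r : ℝ) ≤ t with hR
  have hcH : (Fintype.card H : ℝ) = 2 ^ l := by exact_mod_cast hHc
  have hcard : (Fintype.card (H × Q) : ℝ) = 2 ^ l * Fintype.card Q := by
    rw [Fintype.card_prod]; push_cast; rw [hcH]
  have hl' : 1 ≤ ν * 2 ^ l := by
    have h2 : (1 / 2 : ℝ) ^ l * 2 ^ l = 1 := by rw [← mul_pow]; norm_num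
    have h3 : (0 : ℝ) < 2 ^ l := by positivity
    nlinarith
  refine ⟨H × Q, inferInstance, inferInstance, inferInstance, {0} ×ˢ B, Finset.univ ×ˢ R, hQ,
    ?_, ?_, ?_, ?_⟩
  · rw [hcard, Finset.card_product, Finset.card_singleton, one_mul]
    have h2 : (1 / 2 : ℝ) ^ l * 2 ^ l = 1 := by rw [← mul_pow]; norm_num
    calc κ * (1 / 2) ^ l * (2 ^ l * (Fintype.card Q : ℝ))
        = κ * ((1 / 2) ^ l * 2 ^ l) * Fintype.card Q := by ring
      _ = κ * Fintype.card Q := by rw [h2, mul_one]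
      _ ≤ B.card := hM.le_card
  · have hsub : ({0} ×ˢ B + {0} ×ˢ B : Finset (H × Q)) ⊆ {0} ×ˢ Finset.univ := by
      intro x hx
      obtain ⟨y, hy, z, hz, rfl⟩ := Finset.mem_add.1 hx
      simp only [Finset.mem_product, Finset.mem_singleton] at hy hz ⊢
      simp [hy.1, hz.1]
    have := Finset.card_le_card hsub
    rw [Finset.card_product, Finset.card_singleton, one_mul, Finset.card_univ] at this
    rw [hcard]
    have : ((({0} ×ˢ B + {0} ×ˢ B : Finset (H × Q)).card : ℕ) : ℝ) ≤ Fintype.card Q := by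
      exact_mod_cast this
    nlinarith [(Nat.cast_nonneg (Fintype.card Q) : (0 : ℝ) ≤ _)]
  · intro S hS hs
    have hS' : ∀ r ∈ S.image Prod.snd, (N r : ℝ) ≤ t := by
      intro r hr
      obtain ⟨p, hp, rfl⟩ := Finset.mem_image.1 hr
      have := hS hp
      simp only [Finset.mem_product, hR, Finset.mem_filter, Finset.mem_univ, true_and] at this
      exact this
    have h1 := hM.card_add_le (by positivity) ht0.le hS' (Finset.card_image_le.trans hs)
    have hsub : ({0} ×ˢ B + S : Finset (H × Q)) ⊆ Finset.univ ×ˢ (B + S.image Prod.snd) := by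
      intro x hx
      obtain ⟨y, hy, z, hz, rfl⟩ := Finset.mem_add.1 hx
      simp only [Finset.mem_product, Finset.mem_univ, true_and] at hy ⊢
      exact Finset.add_mem_add hy.2 (Finset.mem_image_of_mem _ hz)
    have h2 := Finset.card_le_card hsub
    rw [Finset.card_product, Finset.card_univ] at h2
    have h3 : (({0} ×ˢ B + S : Finset (H × Q)).card : ℝ) ≤
        2 ^ l * (B + S.image Prod.snd).card := by rw [← hcH]; exact_mod_cast h2
    have h4 : (s : ℝ) * (746496 / d * t) ≤ ν / 2 := by
      rw [div_le_iff₀ (half_pos hν)] at hd2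
      have : (s : ℝ) * (746496 / d * t) = s * 746496 * τ / √(d : ℝ) := by
        rw [ht, eq_div_iff hr.ne']
        calc _ = s * 746496 * τ * √(d : ℝ) ^ 2 / d := by ring
          _ = _ := by rw [hr2, mul_div_cancel_right₀ _ hd0.ne']
      rw [this, div_le_iff₀ hr]
      linarith
    rw [hcard]
    calc _ ≤ (2 : ℝ) ^ l * (B + S.image Prod.snd).card := h3
      _ ≤ 2 ^ l * (ν * Fintype.card Q) := by
        gcongr
        refine h1.trans ?_
        gcongr
        linarith
      _ = _ := by ring
  · intro B' hB' hcB
    have hB'' : B' = {0} ×ˢ B'.image Prod.snd := by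
      ext ⟨a, x⟩
      simp only [Finset.mem_product, Finset.mem_singleton, Finset.mem_image, Prod.exists,
        exists_eq_right]
      constructor
      · intro h
        have := hB' h
        simp only [Finset.mem_product, Finset.mem_singleton] at this
        exact ⟨this.1, a, h⟩
      · rintro ⟨rfl, a, h⟩
        have := hB' h
        simp only [Finset.mem_product, Finset.mem_singleton] at this
        rwa [← this.1]
    generalize B'.image Prod.snd = B₁ at hB''
    subst hB''
    simp only [Finset.card_product, Finset.card_singleton, one_mul] at hcB
    have hexp := VarianceBound.blow_up hM.length hM.variance (β := κ / 2) (t := t) (B := B₁)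
      (by positivity) ht0 (by
        rw [ht, mul_pow, hτ2, hr2, div_le_iff₀ (by positivity)]
        field_simp
        nlinarith) (by linarith [hM.le_card])
    have hsub : Finset.univ ×ˢ (B₁ + R) ⊆ ({0} ×ˢ B₁ + Finset.univ ×ˢ R : Finset (H × Q)) := by
      rintro ⟨a, x⟩ hx
      simp only [Finset.mem_product, Finset.mem_univ, true_and] at hx
      obtain ⟨y, hy, z, hz, rfl⟩ := Finset.mem_add.1 hx
      exact Finset.mem_add.2 ⟨(0, y), by simpa using hy, (a, z), by simpa using hz, by simp⟩
    have h2 := Finset.card_le_card hsub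
    rw [Finset.card_product, Finset.card_univ] at h2
    have h3 : (2 : ℝ) ^ l * (B₁ + R).card ≤
        ({0} ×ˢ B₁ + Finset.univ ×ˢ R : Finset (H × Q)).card := by rw [← hcH]; exact_mod_cast h2
    rw [hcard]
    have : (2 : ℝ) ^ l * Fintype.card Q ≤ 2 ^ l * (2 * (B₁ + R).card) := by gcongr
    linarith

end GroupClass

/-! ### Lifting along a tiling -/

section Transfer

/-- A finite region of `G` cut into the tiles `h + σ Q`, for `h ∈ X`, each of which is mapped
bijectively onto the finite group `Q` by a homomorphism `π`. The section `σ` need not be additive,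
but its cocycle takes at most two values; `Y` contains all sums of two elements of the region, and
meets each fibre of `π` in at most twice as many points as there are tiles. -/
structure Tiling {G Q : Type} [AddCommGroup G] [DecidableEq G] [AddCommGroup Q] [DecidableEq Q]
    (π : G →+ Q) (σ : Q → G) (X Y Z : Finset G) : Prop where
  map_section : ∀ q, π (σ q) = q
  map_base : ∀ h ∈ X, π h = 0
  zero_mem : 0 ∈ X
  cocycle_mem : ∀ a b, σ a + σ b - σ (a + b) ∈ Z
  card_cocycle : Z.card ≤ 2
  add_mem : ∀ h ∈ X, ∀ h' ∈ X, ∀ a b, (h + σ a) + (h' + σ b) ∈ Y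
  card_fibre : ∀ q, (Y.filter fun y => π y = q).card ≤ 2 * X.card

variable {G Q : Type} [AddCommGroup G] [DecidableEq G] [AddCommGroup Q] [DecidableEq Q]
  {π : G →+ Q} {σ : Q → G} {X Y Z : Finset G}

/-- A subset of the region whose image in `Q` lies in `W` has at most `2 * |X| * |W|` elements. -/
lemma Tiling.card_le (hT : Tiling π σ X Y Z) {V : Finset G} {W : Finset Q} (hV : V ⊆ Y)
    (hW : ∀ v ∈ V, π v ∈ W) : V.card ≤ 2 * X.card * W.card := by
  refine Finset.card_le_mul_card_image_of_maps_to hW _ fun q _ => ?_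
  refine (Finset.card_le_card ?_).trans (hT.card_fibre q)
  exact Finset.filter_subset_filter _ hV

/-- Sets `B' h ⊆ Q`, one for each tile, most of which satisfy `2 * |B' h + R| ≥ |Q|`, lift to sets
with a large sumset: a point of `Q` lifts to a given sum from at most two tiles. -/
lemma Tiling.card_sigma_le (hT : Tiling π σ X Y Z) {B' : G → Finset Q} {R : Finset Q}
    {V : Finset G} (hV : ∀ h ∈ X, ∀ b ∈ B' h, ∀ r ∈ R, h + σ b + σ r ∈ V) :
    ∑ h ∈ X, (B' h + R).card ≤ 2 * V.card := by
  rw [← Finset.card_sigma]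
  have hinj : (X.sigma fun h => B' h + R).card ≤
      ((V ×ˢ Z).image fun p => (⟨p.1 - σ (π p.1) - p.2, π p.1⟩ : Σ _ : G, Q)).card := by
    refine Finset.card_le_card ?_
    rintro ⟨h, z⟩ hz
    rw [Finset.mem_sigma] at hz
    obtain ⟨hh, hz⟩ := hz
    obtain ⟨b, hb, r, hr, rfl⟩ := Finset.mem_add.1 hz
    have hπ : π (h + σ b + σ r) = b + r := by
      rw [map_add, map_add, hT.map_section, hT.map_section, hT.map_base h hh, zero_add]
    refine Finset.mem_image.2 ⟨(h + σ b + σ r, σ b + σ r - σ (b + r)),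
      Finset.mem_product.2 ⟨hV h hh b hb r hr, hT.cocycle_mem b r⟩, ?_⟩
    dsimp only
    rw [hπ]
    congr 1
    abel
  refine hinj.trans (Finset.card_image_le.trans ?_)
  rw [Finset.card_product, mul_comm]
  exact Nat.mul_le_mul_right _ hT.card_cocycle

/-- A spread pair `B, R` in `Q` yields a nonsaturating set in `G`: all lifts of `B` to the tiles,
together with one lift of `R`. When there are many tiles the lift of `R` has negligible size. -/
theorem Tiling.exists_isNonSaturating [Fintype Q] (hT : Tiling π σ X Y Z) {ν b : ℝ} {s : ℕ}
    {B R : Finset Q}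
    (hBR : SpreadPair ν b s B R) (hν : 0 < ν) (hb : 0 < b) (hs : (s : ℝ) ≤ ν * X.card)
    (h8 : 8 ≤ b * X.card) :
    ∃ A : Finset G, (∀ a ∈ A, ∃ h ∈ X, ∃ q, a = h + σ q) ∧
      b * ((X.card : ℝ) * Fintype.card Q) ≤ A.card ∧
      IsNonSaturating (40 * ν) (2 / b + 1) (1 / 8) s A := by
  have hQ : (0 : ℝ) < Fintype.card Q := by exact_mod_cast Fintype.card_pos
  have hX : (0 : ℝ) < X.card := by exact_mod_cast Finset.card_pos.2 ⟨0, hT.zero_mem⟩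
  have hπ : ∀ h ∈ X, ∀ q, π (h + σ q) = q := fun h hh q => by
    rw [map_add, hT.map_section, hT.map_base h hh, zero_add]
  set M := (X ×ˢ B).image fun p => p.1 + σ p.2 with hM
  set T := R.image σ with hTR
  have hinj : Set.InjOn (fun p : G × Q => p.1 + σ p.2) (X ×ˢ B : Finset (G × Q)) := by
    rintro ⟨h, q⟩ hp ⟨h', q'⟩ hp' heq
    simp only [Finset.coe_product, Set.mem_prod, Finset.mem_coe] at hp hp' heq
    have : q = q' := by rw [← hπ h hp.1 q, heq, hπ h' hp'.1 q']
    subst this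
    rw [add_left_inj] at heq
    rw [heq]
  have hMc : M.card = X.card * B.card := by
    rw [hM, Finset.card_image_of_injOn hinj, Finset.card_product]
  have hA : ∀ a ∈ M ∪ T, ∃ h ∈ X, ∃ q, a = h + σ q := by
    intro a ha
    rcases Finset.mem_union.1 ha with ha | ha
    · obtain ⟨⟨h, q⟩, hp, rfl⟩ := Finset.mem_image.1 ha
      exact ⟨h, (Finset.mem_product.1 hp).1, q, rfl⟩
    · obtain ⟨q, -, rfl⟩ := Finset.mem_image.1 ha
      exact ⟨0, hT.zero_mem, q, (zero_add _).symm⟩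
  have hY : ∀ a ∈ M ∪ T, ∀ a' ∈ M ∪ T, a + a' ∈ Y := by
    intro a ha a' ha'
    obtain ⟨h, hh, q, rfl⟩ := hA a ha
    obtain ⟨h', hh', q', rfl⟩ := hA a' ha'
    exact hT.add_mem h hh h' hh' q q'
  have hMA : (X.card : ℝ) * B.card ≤ (M ∪ T).card := by
    rw [← Nat.cast_mul, ← hMc]
    exact_mod_cast Finset.card_le_card Finset.subset_union_left
  have hcA : b * ((X.card : ℝ) * Fintype.card Q) ≤ (M ∪ T).card := by
    refine le_trans ?_ hMA
    have := mul_le_mul_of_nonneg_left hBR.le_card hX.le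
    linarith
  have hTc : (T.card : ℝ) ≤ Fintype.card Q := by
    exact_mod_cast Finset.card_image_le.trans (Finset.card_le_univ _)
  have hBpos : (0 : ℝ) < B.card := lt_of_lt_of_le (by positivity) hBR.le_card
  refine ⟨M ∪ T, hA, hcA, ?_, ?_⟩
  · have h1 := hT.card_le (V := M ∪ T + (M ∪ T)) (W := Finset.univ)
      (fun v hv => by
        obtain ⟨a, ha, a', ha', rfl⟩ := Finset.mem_add.1 hv
        exact hY a ha a' ha')
      (fun _ _ => Finset.mem_univ _)
    rw [Finset.card_univ] at h1
    have h2 : ((M ∪ T + (M ∪ T)).card : ℝ) ≤ 2 * X.card * Fintype.card Q := by exact_mod_cast h1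
    have h3 : 2 * (X.card : ℝ) * Fintype.card Q = 2 / b * (b * (X.card * Fintype.card Q)) := by
      field_simp
    have h4 : 2 / b * (b * ((X.card : ℝ) * Fintype.card Q)) ≤ 2 / b * (M ∪ T).card := by gcongr
    have h5 : (0 : ℝ) ≤ (M ∪ T).card := Nat.cast_nonneg _
    linarith
  · intro A' hA' hcA' S hS hSs
    -- lower bound for `A' + A`
    set B' : G → Finset Q := fun h => B.filter fun q => h + σ q ∈ A' with hB'
    have hsum : (A'.card : ℝ) ≤ ∑ h ∈ X, ((B' h).card : ℝ) + T.card := by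
      have hsub : A' ⊆ (X.sigma B').image (fun p : Σ _ : G, Q => p.1 + σ p.2) ∪ T := by
        intro a ha
        rcases Finset.mem_union.1 (hA' ha) with haM | haT
        · obtain ⟨⟨h, q⟩, hp, rfl⟩ := Finset.mem_image.1 haM
          rw [Finset.mem_product] at hp
          exact Finset.mem_union_left _ (Finset.mem_image.2 ⟨⟨h, q⟩,
            Finset.mem_sigma.2 ⟨hp.1, Finset.mem_filter.2 ⟨hp.2, ha⟩⟩, rfl⟩)
        · exact Finset.mem_union_right _ haT
      have h1 := (Finset.card_le_card hsub).trans (Finset.card_union_le _ _)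
      have h2 := Finset.card_image_le (s := X.sigma B') (f := fun p : Σ _ : G, Q => p.1 + σ p.2)
      rw [Finset.card_sigma] at h2
      exact_mod_cast h1.trans (Nat.add_le_add_right h2 _)
    have h34 : 3 / 4 * ((X.card : ℝ) * B.card) ≤ ∑ h ∈ X, ((B' h).card : ℝ) := by
      have h1 : 8 * (Fintype.card Q : ℝ) ≤ X.card * B.card := by
        have h2 := mul_le_mul_of_nonneg_left hBR.le_card hX.le
        have h3 := mul_le_mul_of_nonneg_right h8 hQ.le
        linarith
      linarith
    -- a bound linear in `|B' h|`; it is trivial for tiles where `B' h` is less than half of `B`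
    have hexp : ∀ h ∈ X, (Fintype.card Q : ℝ) * (2 * (B' h).card - B.card) ≤
        2 * B.card * (B' h + R).card := by
      intro h _
      have hle : ((B' h).card : ℝ) ≤ B.card := by
        exact_mod_cast Finset.card_le_card (Finset.filter_subset _ _)
      by_cases hc : (B.card : ℝ) ≤ 2 * (B' h).card
      · have := hBR.le_add _ (Finset.filter_subset _ _) hc
        nlinarith
      · push Not at hc
        have : (0 : ℝ) ≤ 2 * B.card * (B' h + R).card := by positivity
        nlinarith
    have hlow : (X.card : ℝ) * Fintype.card Q ≤ 8 * (A' + (M ∪ T)).card := by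
      have h1 := hT.card_sigma_le (B' := B') (R := R) (V := A' + (M ∪ T)) fun h _ q hq r hr =>
        Finset.add_mem_add (Finset.mem_filter.1 hq).2
          (Finset.mem_union_right _ (Finset.mem_image_of_mem _ hr))
      have h2 : ∑ h ∈ X, ((B' h + R).card : ℝ) ≤ 2 * (A' + (M ∪ T)).card := by exact_mod_cast h1
      have h3 := Finset.sum_le_sum hexp
      rw [← Finset.mul_sum, ← Finset.mul_sum, Finset.sum_sub_distrib, ← Finset.mul_sum,
        Finset.sum_const, nsmul_eq_mul] at h3
      have h4 : (Fintype.card Q : ℝ) * (1 / 2 * ((X.card : ℝ) * B.card)) ≤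
          2 * B.card * (2 * (A' + (M ∪ T)).card) :=
        (mul_le_mul_of_nonneg_left (by linarith) hQ.le).trans
          (h3.trans (mul_le_mul_of_nonneg_left h2 (by positivity)))
      refine le_of_mul_le_mul_left ?_ hBpos
      linarith
    -- upper bound for `A' + S`
    have hup : ((A' + S).card : ℝ) ≤ 5 * ν * (X.card * Fintype.card Q) := by
      set W := (B + B) ∪ (B + (R ∩ S.image π)) with hW
      have hsub : A' + S ⊆ (((M ∪ T) + S).filter fun v => π v ∈ W) ∪ (T + S) := by
        intro v hv
        obtain ⟨a, ha, x, hx, rfl⟩ := Finset.mem_add.1 hv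
        rcases Finset.mem_union.1 (hA' ha) with haM | haT
        · refine Finset.mem_union_left _ (Finset.mem_filter.2
            ⟨Finset.add_mem_add (hA' ha) hx, ?_⟩)
          obtain ⟨⟨h, q⟩, hp, rfl⟩ := Finset.mem_image.1 haM
          rw [Finset.mem_product] at hp
          rw [map_add, hπ h hp.1]
          rcases Finset.mem_union.1 (hS hx) with hxM | hxT
          · obtain ⟨⟨h', q'⟩, hp', rfl⟩ := Finset.mem_image.1 hxM
            rw [Finset.mem_product] at hp'
            rw [hπ h' hp'.1]
            exact Finset.mem_union_left _ (Finset.add_mem_add hp.2 hp'.2)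
          · have hxS := Finset.mem_image_of_mem π hx
            obtain ⟨r, hr, rfl⟩ := Finset.mem_image.1 hxT
            rw [hT.map_section] at hxS ⊢
            exact Finset.mem_union_right _
              (Finset.add_mem_add hp.2 (Finset.mem_inter.2 ⟨hr, hxS⟩))
        · exact Finset.mem_union_right _ (Finset.add_mem_add haT hx)
      have h1 := (Finset.card_le_card hsub).trans (Finset.card_union_le _ _)
      have h2 := hT.card_le (V := ((M ∪ T) + S).filter fun v => π v ∈ W) (W := W)
        (fun v hv => by
          obtain ⟨a, ha, a', ha', rfl⟩ := Finset.mem_add.1 (Finset.mem_filter.1 hv).1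
          exact hY a ha a' (hS ha'))
        (fun v hv => (Finset.mem_filter.1 hv).2)
      have h3 : (W.card : ℝ) ≤ 2 * ν * Fintype.card Q := by
        have e1 : (W.card : ℝ) ≤ (B + B).card + (B + (R ∩ S.image π)).card := by
          exact_mod_cast Finset.card_union_le _ _
        have e2 := hBR.add_le (R ∩ S.image π) Finset.inter_subset_left
          ((Finset.card_le_card Finset.inter_subset_right).trans (Finset.card_image_le.trans hSs))
        linarith [hBR.add_self_le]
      have h4 : ((T + S).card : ℝ) ≤ Fintype.card Q * s := by
        calc ((T + S).card : ℝ) ≤ T.card * S.card := by exact_mod_cast Finset.card_add_le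
          _ ≤ _ := by gcongr
      have h5 : ((A' + S).card : ℝ) ≤ 2 * X.card * W.card + (T + S).card := by
        exact_mod_cast h1.trans (Nat.add_le_add_right h2 _)
      have h6 : 2 * (X.card : ℝ) * W.card ≤ 2 * X.card * (2 * ν * Fintype.card Q) := by gcongr
      have h7 : (Fintype.card Q : ℝ) * s ≤ Fintype.card Q * (ν * X.card) := by gcongr
      linarith
    have := mul_le_mul_of_nonneg_left hlow hν.le
    linarith

end Transfer

/-! ### Intervals of integers -/

section Integers

lemma groupClass_isAddCyclic : GroupClass fun Q _ => IsAddCyclic Q where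
  congr e h := e.isAddCyclic.1 h
  extend Q _ _ h := by
    obtain ⟨q, hq, hp⟩ := Nat.exists_infinite_primes (Fintype.card Q + 1)
    have : Fact q.Prime := ⟨hp⟩
    refine ⟨ZMod q, inferInstance, inferInstance, inferInstance,
      AddGroup.isAddCyclic_prod_iff.2 ⟨h, inferInstance, ?_⟩⟩
    rw [Nat.card_zmod, Nat.card_eq_fintype_card, Nat.coprime_comm]
    exact hp.coprime_iff_not_dvd.2 fun hd =>
      absurd (Nat.le_of_dvd Fintype.card_pos hd) (by omega)
  two_pow l := by
    have : NeZero (2 ^ l) := ⟨by positivity⟩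
    exact ⟨ZMod (2 ^ l), inferInstance, inferInstance, inferInstance, ZMod.card _⟩

/-- The interval `[1, J * |Q|]` consists of `J` tiles over a cyclic group `Q`. -/
lemma exists_tiling_int (Q : Type) [AddCommGroup Q] [Fintype Q] [DecidableEq Q]
    (hQ : IsAddCyclic Q) {J : ℕ} (hJ : 0 < J) :
    ∃ (π : ℤ →+ Q) (σ : Q → ℤ) (X Y Z : Finset ℤ), Tiling π σ X Y Z ∧ X.card = J ∧
      ∀ h ∈ X, ∀ q, h + σ q ∈ Finset.Icc 1 ((J : ℤ) * Fintype.card Q) := by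
  obtain ⟨g, hg⟩ := hQ.exists_generator
  set m : ℤ := (Fintype.card Q : ℤ) with hm
  have hm0 : 0 < m := by rw [hm]; exact_mod_cast Fintype.card_pos
  have hord : (addOrderOf g : ℤ) = m := by
    rw [hm, addOrderOf_eq_card_of_forall_mem_zmultiples hg, Nat.card_eq_fintype_card]
  have hker : ∀ n : ℤ, n • g = 0 ↔ m ∣ n := fun n => by
    rw [← hord, addOrderOf_dvd_iff_zsmul_eq_zero]
  choose τ hτ using fun q => AddSubgroup.mem_zmultiples_iff.1 (hg q)
  set σ : Q → ℤ := fun q => (τ q - 1) % m + 1 with hσ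
  have hσ1 : ∀ q, 1 ≤ σ q := fun q => by
    have := Int.emod_nonneg (τ q - 1) hm0.ne'
    simp only [hσ]; omega
  have hσm : ∀ q, σ q ≤ m := fun q => by
    have := Int.emod_lt_of_pos (τ q - 1) hm0
    simp only [hσ]; omega
  have hσg : ∀ q, σ q • g = q := fun q => by
    have h1 : σ q = τ q - m * ((τ q - 1) / m) := by
      have := Int.emod_add_mul_ediv (τ q - 1) m
      simp only [hσ]; omega
    rw [h1, sub_smul, (hker (m * _)).2 (dvd_mul_right _ _), sub_zero, hτ]
  have hbd : ∀ h ∈ (Finset.range J).image fun j : ℕ => (j : ℤ) * m, ∀ q,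
      1 ≤ h + σ q ∧ h + σ q ≤ (J : ℤ) * m := by
    intro h hh q
    obtain ⟨j, hj, rfl⟩ := Finset.mem_image.1 hh
    have hj' : ((j : ℤ) + 1) * m ≤ J * m :=
      mul_le_mul_of_nonneg_right (by have := Finset.mem_range.1 hj; omega) hm0.le
    have h1 := hσ1 q
    have h2 := hσm q
    have h3 : 0 ≤ (j : ℤ) * m := by positivity
    constructor <;> linarith
  have hcX : ((Finset.range J).image fun j : ℕ => (j : ℤ) * m).card = J := by
    rw [Finset.card_image_of_injective, Finset.card_range]
    intro i j hij
    have := mul_right_cancel₀ hm0.ne' hij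
    exact_mod_cast this
  refine ⟨(zmultiplesHom Q) g, σ, (Finset.range J).image fun j : ℕ => (j : ℤ) * m,
    Finset.Icc 1 (2 * J * m), {0, m}, ⟨fun q => ?_, fun h hh => ?_, ?_, fun a b => ?_, ?_,
    fun h hh h' hh' a b => ?_, fun q => ?_⟩, hcX, fun h hh q => ?_⟩
  · rw [zmultiplesHom_apply, hσg]
  · obtain ⟨j, -, rfl⟩ := Finset.mem_image.1 hh
    rw [zmultiplesHom_apply, hker]
    exact dvd_mul_left _ _
  · exact Finset.mem_image.2 ⟨0, Finset.mem_range.2 hJ, by simp⟩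
  · have hd : m ∣ σ a + σ b - σ (a + b) := by
      rw [← hker, sub_smul, add_smul, hσg, hσg, hσg, sub_self]
    obtain ⟨k, hk⟩ := hd
    have ha := hσ1 a
    have hb := hσ1 b
    have hab := hσ1 (a + b)
    have ha' := hσm a
    have hb' := hσm b
    have hab' := hσm (a + b)
    have hk0 : -1 < k := by
      by_contra hlt
      push Not at hlt
      nlinarith
    have hk2 : k < 2 := by
      by_contra hlt
      push Not at hlt
      nlinarith
    rw [hk]
    have : k = 0 ∨ k = 1 := by omega
    rcases this with rfl | rfl <;> simp
  · exact Finset.card_le_two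
  · have h1 := hbd h hh a
    have h2 := hbd h' hh' b
    rw [Finset.mem_Icc]
    constructor <;> linarith
  · rw [hcX]
    -- a point of the fibre is determined by its tile
    have : (((Finset.Icc 1 (2 * (J : ℤ) * m)).filter fun y => (zmultiplesHom Q) g y = q)).card ≤
        (Finset.Ico (0 : ℤ) (2 * J)).card := by
      refine Finset.card_le_card_of_injOn (fun y => (y - 1) / m) ?_ ?_
      · intro y hy
        rw [Finset.mem_coe, Finset.mem_filter, Finset.mem_Icc] at hy
        rw [Finset.mem_coe, Finset.mem_Ico]
        exact ⟨Int.ediv_nonneg (by omega) hm0.le, Int.ediv_lt_of_lt_mul hm0 (by omega)⟩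
      · intro y hy y' hy' heq
        rw [Finset.mem_coe, Finset.mem_filter, zmultiplesHom_apply] at hy hy'
        dsimp only at heq
        have hd : m ∣ y - y' := by rw [← hker, sub_smul, hy.2, hy'.2, sub_self]
        have h1 : (y - 1) % m = (y' - 1) % m := by
          apply Int.ModEq.symm
          rw [Int.modEq_iff_dvd]
          rwa [show y - 1 - (y' - 1) = y - y' by ring]
        have h2 := Int.emod_add_mul_ediv (y - 1) m
        have h3 := Int.emod_add_mul_ediv (y' - 1) m
        rw [heq, h1] at h2
        omega
    refine this.trans ?_
    rw [Int.card_Ico]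
    omega
  · rw [Finset.mem_Icc]
    exact hbd h hh q

/-- Nonsaturating subsets of `{1, …, N}`, from a spread pair in a cyclic group. -/
lemma exists_isNonSaturating_int {Q : Type} [AddCommGroup Q] [Fintype Q] [DecidableEq Q]
    (hQ : IsAddCyclic Q) {ν b : ℝ} {s : ℕ} {B R : Finset Q} (hBR : SpreadPair ν b s B R)
    (hν : 0 < ν) (hb : 0 < b) :
    ∃ N₀ : ℕ, ∀ N : ℕ, N₀ ≤ N → ∃ A : Finset ℤ, A ⊆ Finset.Icc 1 (N : ℤ) ∧
      b / 2 * (N : ℝ) ≤ A.card ∧ IsNonSaturating (40 * ν) (2 / b + 1) (1 / 8) s A := by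
  obtain ⟨m, hm⟩ := exists_nat_ge (max (s / ν) (8 / b))
  have hm1 := (le_max_left _ _).trans hm
  have hm2 := (le_max_right _ _).trans hm
  rw [div_le_iff₀ hν] at hm1
  rw [div_le_iff₀ hb] at hm2
  have hc : 0 < Fintype.card Q := Fintype.card_pos
  refine ⟨(m + 1) * Fintype.card Q, fun N hN => ?_⟩
  set J := N / Fintype.card Q with hJ
  have hJm : m + 1 ≤ J := (Nat.le_div_iff_mul_le hc).2 hN
  obtain ⟨π, σ, X, Y, Z, hT, hX, hI⟩ := exists_tiling_int Q hQ (J := J) (by omega)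
  have hmJ : (m : ℝ) ≤ X.card := by rw [hX]; exact_mod_cast (by omega : m ≤ J)
  obtain ⟨A, hA, hcA, hns⟩ := hT.exists_isNonSaturating hBR hν hb
    (by nlinarith) (by nlinarith)
  refine ⟨A, fun a ha => ?_, le_trans ?_ hcA, hns⟩
  · obtain ⟨h, hh, q, rfl⟩ := hA a ha
    have := hI h hh q
    rw [Finset.mem_Icc] at this ⊢
    refine ⟨this.1, this.2.trans ?_⟩
    exact_mod_cast Nat.div_mul_le_self _ _
  · have h1 : N ≤ 2 * (X.card * Fintype.card Q) := by
      rw [hX]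
      have h2 := Nat.lt_div_mul_add (a := N) hc
      have h3 : Fintype.card Q ≤ J * Fintype.card Q := Nat.le_mul_of_pos_left _ (by omega)
      rw [← hJ] at h2
      omega
    have h2 : (N : ℝ) ≤ 2 * (X.card * Fintype.card Q) := by exact_mod_cast h1
    nlinarith

end Integers

/-! ### Prime cyclic groups -/

section PrimeFields

/-- The property of being nonsaturating passes to images under homomorphisms which are injective
on `A + A`. -/
lemma IsNonSaturating.image {G G' : Type*} [AddCommGroup G] [DecidableEq G] [AddCommGroup G']
    [DecidableEq G'] {ν K ε : ℝ} {s : ℕ} {A : Finset G} (h : IsNonSaturating ν K ε s A)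
    (f : G →+ G') (hf : Set.InjOn f (A + A : Finset G)) :
    (A.image f).card = A.card ∧ IsNonSaturating ν K ε s (A.image f) := by
  have hA : Set.InjOn f A := by
    intro x hx y hy hxy
    have := hf (Finset.mem_coe.2 (Finset.add_mem_add hx hx))
      (Finset.mem_coe.2 (Finset.add_mem_add hy hx)) (by rw [map_add, map_add, hxy])
    exact add_right_cancel this
  have hadd : ∀ U V : Finset G, U ⊆ A → V ⊆ A → (U.image f + V.image f).card = (U + V).card := by
    intro U V hU hV
    rw [← Finset.image_add, Finset.card_image_of_injOn]
    exact hf.mono (by exact_mod_cast Finset.add_subset_add hU hV)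
  have hcard : ∀ U ⊆ A, (U.image f).card = U.card := fun U hU =>
    Finset.card_image_of_injOn (hA.mono (by exact_mod_cast hU))
  refine ⟨hcard A subset_rfl, ?_, ?_⟩
  · rw [hadd A A subset_rfl subset_rfl, hcard A subset_rfl]
    exact h.1
  · intro U hU hcU S hS hSs
    obtain ⟨U, hU', rfl⟩ := Finset.subset_image_iff.1 hU
    obtain ⟨S, hS', rfl⟩ := Finset.subset_image_iff.1 hS
    have hU'' : U ⊆ A := by exact_mod_cast hU'
    have hS'' : S ⊆ A := by exact_mod_cast hS'
    rw [hcard A subset_rfl, hcard U hU''] at hcU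
    rw [hcard S hS''] at hSs
    rw [hadd U S hU'' hS'', hadd U A hU'' subset_rfl]
    exact h.2 U hU'' hcU S hS'' hSs

/-- Reduction modulo `p` transfers nonsaturating sets from `{1, …, (p - 1) / 2}` to `ℤ/pℤ`. -/
lemma exists_isNonSaturating_zmod {ν K ε c : ℝ} {s N₀ : ℕ} (hc : 0 ≤ c)
    (h : ∀ N : ℕ, N₀ ≤ N → ∃ A : Finset ℤ, A ⊆ Finset.Icc 1 (N : ℤ) ∧
      c * (N : ℝ) ≤ A.card ∧ IsNonSaturating ν K ε s A) {p : ℕ} (hp : 2 * N₀ + 4 ≤ p) :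
    ∃ A : Finset (ZMod p), c / 4 * (p : ℝ) ≤ A.card ∧ IsNonSaturating ν K ε s A := by
  obtain ⟨A, hA, hcA, hns⟩ := h ((p - 1) / 2) (by omega)
  obtain ⟨h1, h2⟩ := hns.image (Int.castAddHom (ZMod p)) (by
    intro x hx y hy hxy
    obtain ⟨a, ha, a', ha', rfl⟩ := Finset.mem_add.1 (Finset.mem_coe.1 hx)
    obtain ⟨b, hb, b', hb', rfl⟩ := Finset.mem_add.1 (Finset.mem_coe.1 hy)
    have ha := Finset.mem_Icc.1 (hA ha)
    have ha' := Finset.mem_Icc.1 (hA ha')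
    have hb := Finset.mem_Icc.1 (hA hb)
    have hb' := Finset.mem_Icc.1 (hA hb')
    rw [Int.coe_castAddHom, ZMod.intCast_eq_intCast_iff] at hxy
    have := hxy
    unfold Int.ModEq at this
    rwa [Int.emod_eq_of_lt (by omega) (by omega), Int.emod_eq_of_lt (by omega) (by omega)] at this)
  refine ⟨_, ?_, h2⟩
  rw [h1]
  refine le_trans ?_ hcA
  have : (p : ℝ) ≤ 4 * ((p - 1) / 2 : ℕ) := by exact_mod_cast (by omega)
  nlinarith

end PrimeFields

/-! ### Vector spaces over the field with two elements -/

section BinaryVectors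

lemma groupClass_two_torsion : GroupClass fun Q _ => ∀ x : Q, x + x = 0 where
  congr e h x := by
    have := congrArg e (h (e.symm x))
    simpa using this
  extend Q _ _ h := ⟨ZMod 2, inferInstance, inferInstance, inferInstance, fun x =>
    Prod.ext (h _) (CharTwo.add_self_eq_zero _)⟩
  two_pow l := ⟨Fin l → ZMod 2, inferInstance, inferInstance, fun x =>
    funext fun _ => CharTwo.add_self_eq_zero _, by simp⟩

/-- `𝔽₂ⁿ` consists of tiles over any group `Q` of exponent two and smaller order. -/
lemma exists_tiling_binary (Q : Type) [AddCommGroup Q] [Fintype Q] [DecidableEq Q]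
    (hQ : ∀ x : Q, x + x = 0) {n : ℕ} (hn : Fintype.card Q ≤ n) :
    ∃ (π : (Fin n → ZMod 2) →+ Q) (σ : Q → Fin n → ZMod 2) (X Y Z : Finset (Fin n → ZMod 2)),
      Tiling π σ X Y Z ∧ X.card * Fintype.card Q = 2 ^ n := by
  let _ : Module (ZMod 2) Q := AddCommGroup.zmodModule fun x => by rw [two_nsmul, hQ]
  have hd : Module.finrank (ZMod 2) Q ≤ n := by
    have h1 := Module.card_eq_pow_finrank (K := ZMod 2) (V := Q)
    have h2 := Nat.lt_two_pow_self (n := Module.finrank (ZMod 2) Q)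
    rw [ZMod.card] at h1
    omega
  let e := (Module.finBasis (ZMod 2) Q).equivFun
  let π : (Fin n → ZMod 2) →ₗ[ZMod 2] Q :=
    e.symm.toLinearMap ∘ₗ LinearMap.funLeft (ZMod 2) (ZMod 2) (Fin.castLE hd)
  have hπ : Function.Surjective π := by
    rw [LinearMap.coe_comp]
    exact e.symm.surjective.comp
      (LinearMap.funLeft_surjective_of_injective _ _ _ (Fin.castLE_injective hd))
  obtain ⟨σ, hσ⟩ := π.exists_rightInverse_of_surjective (LinearMap.range_eq_top.2 hπ)
  have hσ' : ∀ q, π (σ q) = q := fun q => LinearMap.congr_fun hσ q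
  have hfib : ∀ q, (Finset.univ.filter fun y => π y = q).card =
      (Finset.univ.filter fun y => π y = 0).card := by
    intro q
    refine Finset.card_bij' (fun y _ => y - σ q) (fun y _ => y + σ q) ?_ ?_ ?_ ?_ <;>
      simp +contextual [hσ']
  refine ⟨π.toAddMonoidHom, σ, Finset.univ.filter fun y => π y = 0, Finset.univ, {0},
    ⟨hσ', fun h hh => (Finset.mem_filter.1 hh).2, by simp, fun a b => by simp, by simp,
      fun _ _ _ _ _ _ => Finset.mem_univ _, fun q => ?_⟩, ?_⟩
  · have := hfib q
    refine le_trans (le_of_eq this) (by omega)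
  · have := Finset.card_eq_sum_card_fiberwise (f := π) (s := Finset.univ) (t := Finset.univ)
      (fun _ _ => Finset.mem_coe.2 (Finset.mem_univ _))
    rw [Finset.sum_congr rfl fun q _ => hfib q, Finset.sum_const, Finset.card_univ,
      Finset.card_univ, smul_eq_mul, mul_comm] at this
    rw [← this]
    simp

/-- Nonsaturating subsets of `𝔽₂ⁿ`, from a spread pair in a group of exponent two. -/
lemma exists_isNonSaturating_binary {Q : Type} [AddCommGroup Q] [Fintype Q] [DecidableEq Q]
    (hQ : ∀ x : Q, x + x = 0) {ν b : ℝ} {s : ℕ} {B R : Finset Q} (hBR : SpreadPair ν b s B R)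
    (hν : 0 < ν) (hb : 0 < b) :
    ∃ n₀ : ℕ, ∀ n : ℕ, n₀ ≤ n → ∃ A : Finset (Fin n → ZMod 2),
      b * (2 : ℝ) ^ n ≤ A.card ∧ IsNonSaturating (40 * ν) (2 / b + 1) (1 / 8) s A := by
  obtain ⟨m, hm⟩ := exists_nat_ge (max (s / ν) (8 / b))
  have hm1 := (le_max_left _ _).trans hm
  have hm2 := (le_max_right _ _).trans hm
  rw [div_le_iff₀ hν] at hm1
  rw [div_le_iff₀ hb] at hm2
  have hc : 0 < Fintype.card Q := Fintype.card_pos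
  refine ⟨(m + 1) * Fintype.card Q, fun n hn => ?_⟩
  obtain ⟨π, σ, X, Y, Z, hT, hX⟩ := exists_tiling_binary Q hQ (n := n) (by nlinarith)
  have hmX : m ≤ X.card := by
    refine Nat.le_of_mul_le_mul_right ?_ hc
    rw [hX]
    have := Nat.lt_two_pow_self (n := n)
    nlinarith
  have hmX' : (m : ℝ) ≤ X.card := by exact_mod_cast hmX
  obtain ⟨A, -, hcA, hns⟩ := hT.exists_isNonSaturating hBR hν hb
    (by nlinarith) (by nlinarith)
  refine ⟨A, le_trans (le_of_eq ?_) hcA, hns⟩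
  congr 1
  exact_mod_cast hX.symm

end BinaryVectors

/-! ### Nonsaturating sets -/

theorem theorem1p8 :
    (∀ ν : ℝ, 0 < ν → ∃ K ε c : ℝ, 1 < K ∧ 0 < ε ∧ ε < 1 ∧ 0 < c ∧
      ∀ s : ℕ, ∃ N₀ : ℕ,
        (∀ p : ℕ, p.Prime → N₀ ≤ p → ∃ A : Finset (ZMod p),
          c * (p : ℝ) ≤ (A.card : ℝ) ∧ IsNonSaturating ν K ε s A) ∧
        (∀ N : ℕ, N₀ ≤ N → ∃ A : Finset ℤ, A ⊆ Finset.Icc 1 (N : ℤ) ∧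
          c * (N : ℝ) ≤ (A.card : ℝ) ∧ IsNonSaturating ν K ε s A) ∧
        (∀ n : ℕ, N₀ ≤ n → ∃ A : Finset (Fin n → ZMod 2),
          c * (2 : ℝ) ^ n ≤ (A.card : ℝ) ∧ IsNonSaturating ν K ε s A)) ∧
    ¬ BoundedSaturation := by
  have main : ∀ ν : ℝ, 0 < ν → ∃ K ε c : ℝ, 1 < K ∧ 0 < ε ∧ ε < 1 ∧ 0 < c ∧
      ∀ s : ℕ, ∃ N₀ : ℕ,
        (∀ p : ℕ, p.Prime → N₀ ≤ p → ∃ A : Finset (ZMod p),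
          c * (p : ℝ) ≤ (A.card : ℝ) ∧ IsNonSaturating ν K ε s A) ∧
        (∀ N : ℕ, N₀ ≤ N → ∃ A : Finset ℤ, A ⊆ Finset.Icc 1 (N : ℤ) ∧
          c * (N : ℝ) ≤ (A.card : ℝ) ∧ IsNonSaturating ν K ε s A) ∧
        (∀ n : ℕ, N₀ ≤ n → ∃ A : Finset (Fin n → ZMod 2),
          c * (2 : ℝ) ^ n ≤ (A.card : ℝ) ∧ IsNonSaturating ν K ε s A) := by
    intro ν hν
    have hν' : 0 < ν / 40 := by positivity
    obtain ⟨b, hb, hspread⟩ := exists_spreadPair hν'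
    refine ⟨2 / b + 1, 1 / 8, b / 8, by linarith [div_pos two_pos hb], by norm_num, by norm_num,
      by positivity, fun s => ?_⟩
    obtain ⟨Q, _, _, _, B, R, hQ, hBR⟩ := hspread _ groupClass_isAddCyclic s
    obtain ⟨Q', _, _, _, B', R', hQ', hBR'⟩ := hspread _ groupClass_two_torsion s
    obtain ⟨N₁, h₁⟩ := exists_isNonSaturating_int hQ hBR hν' hb
    obtain ⟨N₂, h₂⟩ := exists_isNonSaturating_binary hQ' hBR' hν' hb
    rw [show 40 * (ν / 40) = ν by ring] at h₁ h₂
    refine ⟨2 * N₁ + 4 + N₂, fun p _ hp => ?_, fun N hN => ?_, fun n hn => ?_⟩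
    · obtain ⟨A, hA, hns⟩ := exists_isNonSaturating_zmod (by positivity) h₁ (p := p) (by omega)
      exact ⟨A, by linarith, hns⟩
    · obtain ⟨A, hA, hcA, hns⟩ := h₁ N (by omega)
      refine ⟨A, hA, le_trans ?_ hcA, hns⟩
      gcongr
      norm_num
    · obtain ⟨A, hcA, hns⟩ := h₂ n (by omega)
      refine ⟨A, le_trans ?_ hcA, hns⟩
      gcongr
      linarith
  refine ⟨main, fun hBS => ?_⟩
  obtain ⟨K, ε, c, hK, hε, hε1, hc, hmain⟩ := main (1 / 4) (by norm_num)
  obtain ⟨C, -, hC⟩ := hBS (min ε (1 / 2)) (by positivity) K (by linarith)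
  obtain ⟨N₀, hp, -, -⟩ := hmain ⌊C⌋₊
  obtain ⟨p, hpN, hpp⟩ := Nat.exists_infinite_primes N₀
  obtain ⟨A, hA, hns⟩ := hp p hpp hpN
  obtain ⟨A', B', hA', hB', hcA', hcB', hsat⟩ := hC p hpp A.card A A rfl rfl hns.1
  have hpos : (0 : ℝ) < A.card :=
    lt_of_lt_of_le (mul_pos hc (by exact_mod_cast hpp.pos)) hA
  have hm1 := min_le_left ε (1 / 2)
  have hm2 := min_le_right ε (1 / 2)
  have h1 := hns.2 A' hA' (by nlinarith) B' hB' (Nat.le_floor hcB')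
  have hA'pos : (0 : ℝ) < A'.card := by nlinarith
  have hne : (A' + A).Nonempty := by
    refine Finset.Nonempty.add ?_ ?_
    · exact Finset.card_pos.1 (by exact_mod_cast hA'pos)
    · exact Finset.card_pos.1 (by exact_mod_cast hpos)
  have hcpos : (0 : ℝ) < (A' + A).card := by exact_mod_cast hne.card_pos
  nlinarith
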